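/- Let $k\ge 3$ and $n\ge 6k-9$ be integers, and let $\mathcal F$ be an intersecting family of $k$-element subsets of $[n]=\{1,\dots,n\}$, that is, $F\cap F'\neq\emptyset$ for all $F,F'\in\mathcal F$. For $x\in[n]$, the degree of $x$ is the number of members of $\mathcal F$ containing $x$. Let $d_1(\mathcal F)\ge d_2(\mathcal F)\ge\dots\ge d_n(\mathcal F)$ be the degrees of the elements of $[n]$, listed with multiplicity in non-increasing order. Then \[ d_{2k+1}(\mathcal F)\le\binom{n-2}{k-2}. \] -/

import Mathlib

/-- The degree of the vertex `x` in the family `F`: the number of members of `F` containing `x`. -/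
def vertexDegree {n : ℕ} (F : Finset (Finset (Fin n))) (x : Fin n) : ℕ :=
  (F.filter (fun A => x ∈ A)).card

/-- A permutation `x₁, …, xₙ` of the ground set with `deg x₁ ≥ deg x₂ ≥ … ≥ deg xₙ`. -/
def degreeOrdering {n : ℕ} (F : Finset (Finset (Fin n))) : Equiv.Perm (Fin n) :=
  Tuple.sort (fun x => OrderDual.toDual (vertexDegree F x))

/-- The `i`-th largest degree `d_i(F)` of `F`, for `1 ≤ i ≤ n` (degrees are counted with
multiplicity, one for each vertex). -/
def ithLargestDegree {n : ℕ} (F : Finset (Finset (Fin n))) (i : ℕ) (h1 : 1 ≤ i) (hn : i ≤ n) : ℕ :=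
  vertexDegree F (degreeOrdering F ⟨i - 1, by omega⟩)

theorem degreeOrdering_antitone {n : ℕ} (F : Finset (Finset (Fin n))) :
    Antitone (fun j => vertexDegree F (degreeOrdering F j)) := by
  intro a b hab
  exact OrderDual.toDual_le_toDual.mp
    (Tuple.monotone_sort (fun x => OrderDual.toDual (vertexDegree F x)) hab)

/-- The value of `d_i(F)` does not depend on the chosen ordering of the vertices by degree. -/
theorem ithLargestDegree_eq {n : ℕ} (F : Finset (Finset (Fin n))) (σ : Equiv.Perm (Fin n))
    (hσ : Antitone (fun j => vertexDegree F (σ j))) (i : ℕ) (h1 : 1 ≤ i) (hn : i ≤ n) :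
    ithLargestDegree F i h1 hn = vertexDegree F (σ ⟨i - 1, by omega⟩) := by
  have h : (fun x => OrderDual.toDual (vertexDegree F x)) ∘ σ =
      (fun x => OrderDual.toDual (vertexDegree F x)) ∘ degreeOrdering F :=
    Tuple.comp_sort_eq_comp_iff_monotone.mpr (fun a b hab => OrderDual.toDual_le_toDual.mpr (hσ hab))
  exact (congrArg OrderDual.ofDual (congrFun h ⟨i - 1, by omega⟩)).symm

/-! Suppose all vertices of a set `D` of size `2k+1` have degree above `C(n-2,k-2)`, and split the
members of `F` by their trace on a pair `{x,y}`. Those containing both points cross-intersect those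
containing neither, so Kruskal-Katona trades one count against the other. A `k`-set covers at most
half of `D \ {x}`, and averaging over that set gives `choose_lt_card_notMem_mem`: for every `y` in
`D` and every `x ≠ y`, more than `C(n-5,k-2)` members contain `y` but not `x`. Since `n - 3 ≥
6(k-2)`, this is at least `2/3` of `M = C(n-3,k-2)`.

For `x, y` in `D`, the members with `x` but not `y` and those with `y` but not `x`, stripped of that
point, cross-intersect. By `exists_common_center`, families this large have a common point `u`
missed by fewer than `M/6` members of each. Shifting reduces this to the case where one family is
shifted; there the least vertex works, because the parts avoiding it are cross 2-intersecting and
the reflection principle makes one of them small.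

For fixed `x`, two choices `y, z` of the second point must give the same centre `u`. Then fewer than
`M/2` members contain `x` and miss `u`, against the lower bound `2M/3`. -/

/-! ### Kruskal-Katona for cross-intersecting families -/

open Finset FinsetFamily in
theorem card_add_choose_le_of_cross_fin {N a b j : ℕ} (X Y : Finset (Finset (Fin N)))
    (hX : ∀ A ∈ X, #A = a) (hY : ∀ B ∈ Y, #B = b)
    (hXY : ∀ A ∈ X, ∀ B ∈ Y, ¬ Disjoint A B) (hj : j ≤ b) (hab : a + b ≤ N)
    (hc : (N - j).choose (b - j) ≤ #Y) : #X + (N - j).choose a ≤ N.choose a := by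
  have hs : ((Yᶜˢ : Finset (Finset (Fin N))) : Set (Finset (Fin N))).Sized (N - b) := by
    intro A hA
    have h := hY _ (mem_compls.1 (mem_coe.1 hA))
    rw [card_compl, Fintype.card_fin] at h
    have := card_finset_fin_le A
    omega
  have hc' : (N - j).choose (N - b) ≤ #(Yᶜˢ) := by
    rw [card_compls, Nat.choose_symm_of_eq_add (show N - j = (N - b) + (b - j) by omega)]
    exact hc
  -- Meeting `B` means not lying inside its complement, so `X` avoids the `a`-level shadow of the
  -- complements of `Y`; Lovász's form bounds that shadow from below.
  have kk := kruskal_katona_lovasz_form (i := N - b - a) (by omega) (by omega) (by omega) hs hc'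
  rw [show N - b - (N - b - a) = a by omega] at kk
  have hdisj : Disjoint X (∂^[N - b - a] Yᶜˢ) := by
    rw [Finset.disjoint_left]
    intro A hA hA'
    obtain ⟨T, hT, hAT, -⟩ := mem_shadow_iterate_iff_exists_sdiff.1 hA'
    refine hXY A hA _ (mem_compls.1 hT) ?_
    rw [disjoint_compl_right_iff]
    exact hAT
  have hsub : X ∪ ∂^[N - b - a] Yᶜˢ ⊆ powersetCard a univ := by
    intro A hA
    rw [mem_powersetCard]
    refine ⟨subset_univ _, ?_⟩
    rcases mem_union.1 hA with hA | hA
    · exact hX A hA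
    · have := hs.shadow_iterate (k := N - b - a) hA
      omega
  have := card_le_card hsub
  rw [card_union_of_disjoint hdisj, card_powersetCard, card_univ, Fintype.card_fin] at this
  omega

open Finset in
/-- A cross-intersecting form of the Kruskal-Katona theorem: if `Y` is at least as large as the
family of `b`-sets containing `j` fixed points, then `X` is at most as large as the family of
`a`-sets meeting a fixed `j`-set. -/
theorem card_add_choose_le_of_cross {α : Type*} [DecidableEq α] {a b j : ℕ} (V : Finset α)
    (X Y : Finset (Finset α)) (hX : ∀ A ∈ X, A ⊆ V ∧ #A = a) (hY : ∀ B ∈ Y, B ⊆ V ∧ #B = b)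
    (hXY : ∀ A ∈ X, ∀ B ∈ Y, ¬ Disjoint A B) (hj : j ≤ b) (hab : a + b ≤ #V)
    (hc : (#V - j).choose (b - j) ≤ #Y) : #X + (#V - j).choose a ≤ (#V).choose a := by
  let φ : Finset α → Finset (Fin #V) :=
    fun A => (A.subtype (· ∈ V)).map V.equivFin.toEmbedding
  have hsub : ∀ A ⊆ V, (A.subtype (· ∈ V)).map (Function.Embedding.subtype _) = A :=
    fun A hA => subtype_map_of_mem hA
  have hcard : ∀ A ⊆ V, #(φ A) = #A := by
    intro A hA
    rw [card_map]
    conv_rhs => rw [← hsub A hA, card_map]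
  have hinj : Set.InjOn φ {A | A ⊆ V} := by
    intro A hA B hB h
    have := map_injective _ h
    rw [← hsub A hA, ← hsub B hB, this]
  have hX' : #(X.image φ) = #X :=
    card_image_of_injOn (hinj.mono fun A hA => (hX A hA).1)
  have hY' : #(Y.image φ) = #Y :=
    card_image_of_injOn (hinj.mono fun A hA => (hY A hA).1)
  rw [← hX']
  rw [← hY'] at hc
  refine card_add_choose_le_of_cross_fin (b := b) _ (Y.image φ) ?_ ?_ ?_ hj hab hc
  · simp only [mem_image, forall_exists_index, and_imp]
    rintro _ A hA rfl
    rw [hcard A (hX A hA).1, (hX A hA).2]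
  · simp only [mem_image, forall_exists_index, and_imp]
    rintro _ A hA rfl
    rw [hcard A (hY A hA).1, (hY A hA).2]
  · simp only [mem_image, forall_exists_index, and_imp]
    rintro _ A hA rfl _ B hB rfl h
    refine hXY A hA B hB ?_
    rw [disjoint_map] at h
    rw [Finset.disjoint_left] at h ⊢
    intro x hxA hxB
    exact h (a := ⟨x, (hX A hA).1 hxA⟩) (by simpa using hxA) (by simpa using hxB)

open Finset in
theorem card_le_choose_of_trace {α : Type*} [DecidableEq α] {a : ℕ} {V Q Q₁ : Finset α}
    (X : Finset (Finset α)) (hX : ∀ A ∈ X, A ⊆ V ∧ #A = a ∧ A ∩ Q = Q₁) :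
    #X ≤ (#(V \ Q)).choose (a - #Q₁) := by
  rw [← card_powersetCard]
  refine card_le_card_of_injOn (fun A => A \ Q) ?_ ?_
  · intro A hA
    obtain ⟨h1, h2, h3⟩ := hX A hA
    rw [mem_coe, mem_powersetCard]
    refine ⟨sdiff_subset_sdiff h1 le_rfl, ?_⟩
    have := card_sdiff_add_card_inter A Q
    rw [h3] at this
    change #(A \ Q) = _
    omega
  · intro A hA B hB h
    have h1 := sdiff_union_inter A Q
    rw [(hX A hA).2.2, show A \ Q = B \ Q from h, ← (hX B hB).2.2, sdiff_union_inter] at h1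
    exact h1.symm

open Finset in
/-- `card_add_choose_le_of_cross` for families with constant disjoint traces on `Q`. -/
theorem card_add_choose_le_of_cross_trace {α : Type*} [DecidableEq α] {a b j N : ℕ}
    (V Q Q₁ Q₂ : Finset α) (X Y : Finset (Finset α))
    (hX : ∀ A ∈ X, A ⊆ V ∧ #A = a + #Q₁ ∧ A ∩ Q = Q₁)
    (hY : ∀ B ∈ Y, B ⊆ V ∧ #B = b + #Q₂ ∧ B ∩ Q = Q₂)
    (hQ : Disjoint Q₁ Q₂) (hN : #(V \ Q) = N)
    (hXY : ∀ A ∈ X, ∀ B ∈ Y, ¬ Disjoint A B) (hj : j ≤ b) (hab : a + b ≤ N)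
    (hc : (N - j).choose (b - j) ≤ #Y) : #X + (N - j).choose a ≤ N.choose a := by
  have key : ∀ (Z : Finset (Finset α)) (c : ℕ) (P : Finset α),
      (∀ A ∈ Z, A ⊆ V ∧ #A = c + #P ∧ A ∩ Q = P) →
      #(Z.image (· \ Q)) = #Z ∧ ∀ A ∈ Z.image (· \ Q), A ⊆ V \ Q ∧ #A = c := by
    intro Z c P hZ
    refine ⟨card_image_of_injOn ?_, ?_⟩
    · intro A hA B hB h
      have h1 := sdiff_union_inter A Q
      rw [(hZ A hA).2.2, show A \ Q = B \ Q from h, ← (hZ B hB).2.2, sdiff_union_inter] at h1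
      exact h1.symm
    · simp only [mem_image, forall_exists_index, and_imp]
      rintro _ A hA rfl
      obtain ⟨h1, h2, h3⟩ := hZ A hA
      refine ⟨sdiff_subset_sdiff h1 le_rfl, ?_⟩
      have := card_sdiff_add_card_inter A Q
      rw [h3] at this
      omega
  obtain ⟨hX1, hX2⟩ := key X a Q₁ hX
  obtain ⟨hY1, hY2⟩ := key Y b Q₂ hY
  subst hN
  rw [← hX1]
  rw [← hY1] at hc
  refine card_add_choose_le_of_cross (V \ Q) _ _ hX2 hY2 ?_ hj hab hc
  simp only [mem_image, forall_exists_index, and_imp]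
  rintro _ A hA rfl _ B hB rfl h
  refine hXY A hA B hB ?_
  rw [Finset.disjoint_left] at h hQ ⊢
  intro x hxA hxB
  by_cases hx : x ∈ Q
  · exact hQ (a := x) ((hX A hA).2.2 ▸ mem_inter.2 ⟨hxA, hx⟩)
      ((hY B hB).2.2 ▸ mem_inter.2 ⟨hxB, hx⟩)
  · exact h (mem_sdiff.2 ⟨hxA, hx⟩) (mem_sdiff.2 ⟨hxB, hx⟩)

/-! ### Shifting -/

/-- The `(i, j)`-shift of a set: replace `j` by `i` if possible. -/
def shiftSet {α : Type*} [DecidableEq α] (i j : α) (A : Finset α) : Finset α :=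
  if j ∈ A ∧ i ∉ A then insert i (A.erase j) else A

/-- The image of the member `A` of `B` when the family `B` is shifted. -/
def shiftMember {α : Type*} [DecidableEq α] (i j : α) (B : Finset (Finset α)) (A : Finset α) :
    Finset α :=
  if shiftSet i j A ∈ B then A else shiftSet i j A

/-- The `(i, j)`-shift of a family. -/
def shiftFamily {α : Type*} [DecidableEq α] (i j : α) (B : Finset (Finset α)) :
    Finset (Finset α) :=
  B.image (shiftMember i j B)

section Shift

open Finset

theorem shiftSet_of_mem {α : Type*} [DecidableEq α] {i j : α} {A : Finset α} (hj : j ∈ A)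
    (hi : i ∉ A) : shiftSet i j A = insert i (A.erase j) :=
  if_pos ⟨hj, hi⟩

theorem mem_shiftFamily {α : Type*} [DecidableEq α] {i j : α} {B : Finset (Finset α)}
    {A : Finset α} (h : A ∈ shiftFamily i j B) :
    (A ∈ B ∧ shiftSet i j A ∈ B) ∨
      ∃ A' ∈ B, j ∈ A' ∧ i ∉ A' ∧ A = insert i (A'.erase j) ∧ A ∉ B := by
  obtain ⟨A', hA', rfl⟩ := mem_image.1 h
  unfold shiftMember
  split_ifs with h1
  · exact Or.inl ⟨hA', h1⟩
  · right
    have h2 : j ∈ A' ∧ i ∉ A' := by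
      by_contra h2
      rw [shiftSet, if_neg h2] at h1
      exact h1 hA'
    exact ⟨A', hA', h2.1, h2.2, shiftSet_of_mem h2.1 h2.2, h1⟩

theorem shiftMember_injOn {α : Type*} [DecidableEq α] (i j : α) (B : Finset (Finset α)) :
    Set.InjOn (shiftMember i j B) B := by
  intro A hA A' hA' h
  unfold shiftMember at h
  rw [mem_coe] at hA hA'
  split_ifs at h with h1 h2 h2
  · exact h
  · exact absurd (h ▸ hA) h2
  · exact absurd (h ▸ hA') h1
  · unfold shiftSet at h h1 h2
    split_ifs at h h1 h2 with h3 h4 h4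
    · have key : ∀ S : Finset α, j ∈ S → i ∉ S → insert j ((insert i (S.erase j)).erase i) = S := by
        intro S hj hi
        rw [erase_insert (by simp [hi]), insert_erase hj]
      rw [← key A h3.1 h3.2, h, key A' h4.1 h4.2]
    · exact absurd hA' h2
    · exact absurd hA h1
    · exact h

theorem card_shiftFamily {α : Type*} [DecidableEq α] (i j : α) (B : Finset (Finset α)) :
    #(shiftFamily i j B) = #B :=
  card_image_of_injOn (shiftMember_injOn i j B)

theorem shiftFamily_sized {α : Type*} [DecidableEq α] {i j : α} {B : Finset (Finset α)}
    {V : Finset α} {l : ℕ} (hi : i ∈ V) (hB : ∀ A ∈ B, A ⊆ V ∧ #A = l) :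
    ∀ A ∈ shiftFamily i j B, A ⊆ V ∧ #A = l := by
  intro A hA
  rcases mem_shiftFamily hA with h | ⟨A', hA', hj, hi', rfl, -⟩
  · exact hB A h.1
  · obtain ⟨h1, h2⟩ := hB A' hA'
    refine ⟨insert_subset hi ((erase_subset _ _).trans h1), ?_⟩
    rw [card_insert_of_notMem (by simp [hi']), card_erase_add_one hj, h2]

/-- The case of one fixed and one moved member. If they were disjoint, `A` would meet `A'` only in
`j`, and the shift of `A`, also in `B`, would miss `A'`. -/
theorem not_disjoint_shift_aux {α : Type*} [DecidableEq α] {i j : α} {B C : Finset (Finset α)}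
    (hBC : ∀ A ∈ B, ∀ A' ∈ C, ¬ Disjoint A A') {A A' : Finset α} (hA : A ∈ B)
    (hsA : shiftSet i j A ∈ B) (hA' : A' ∈ C) (hi' : i ∉ A') :
    ¬ Disjoint A (insert i (A'.erase j)) := by
  intro hd
  rw [disjoint_insert_right] at hd
  obtain ⟨x, hx, hx'⟩ := not_disjoint_iff.1 (hBC A hA A' hA')
  have hxj : ∀ x, x ∈ A → x ∈ A' → x = j := by
    intro x hx hx'
    by_contra hne
    exact (Finset.disjoint_left.1 hd.2 hx) (mem_erase.2 ⟨hne, hx'⟩)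
  obtain rfl := hxj x hx hx'
  rw [shiftSet_of_mem hx hd.1] at hsA
  obtain ⟨y, hy, hy'⟩ := not_disjoint_iff.1 (hBC _ hsA A' hA')
  rcases mem_insert.1 hy with rfl | hy
  · exact hi' hy'
  · exact (mem_erase.1 hy).1 (hxj y (mem_erase.1 hy).2 hy')

theorem shiftFamily_cross {α : Type*} [DecidableEq α] (i j : α) {B C : Finset (Finset α)}
    (hBC : ∀ A ∈ B, ∀ A' ∈ C, ¬ Disjoint A A') :
    ∀ A ∈ shiftFamily i j B, ∀ A' ∈ shiftFamily i j C, ¬ Disjoint A A' := by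
  intro A hA A' hA'
  rcases mem_shiftFamily hA with ⟨h1, h2⟩ | ⟨S, hS, hjS, hiS, rfl, -⟩
  · rcases mem_shiftFamily hA' with ⟨h3, h4⟩ | ⟨S', hS', hjS', hiS', rfl, -⟩
    · exact hBC A h1 A' h3
    · exact not_disjoint_shift_aux hBC h1 h2 hS' hiS'
  · rcases mem_shiftFamily hA' with ⟨h3, h4⟩ | ⟨S', hS', hjS', hiS', rfl, -⟩
    · intro hd
      exact not_disjoint_shift_aux (fun X hX Y hY h => hBC Y hY X hX h.symm) h3 h4 hS hiS hd.symm
    · exact not_disjoint_iff.2 ⟨i, mem_insert_self _ _, mem_insert_self _ _⟩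

/-- Shifting inserts no point but `i`, so a centre `u ≠ i` of the shifted family is already a centre
of the original. -/
theorem card_filter_notMem_le_shiftFamily {α : Type*} [DecidableEq α] {i u : α} (j : α)
    (B : Finset (Finset α)) (hu : u ≠ i) :
    #(B.filter (u ∉ ·)) ≤ #((shiftFamily i j B).filter (u ∉ ·)) := by
  refine card_le_card_of_injOn (shiftMember i j B) ?_
    ((shiftMember_injOn i j B).mono (filter_subset _ _))
  intro A hA
  rw [mem_coe, mem_filter] at hA ⊢
  refine ⟨mem_image_of_mem _ hA.1, ?_⟩
  unfold shiftMember shiftSet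
  split_ifs <;> simp [hA.2, hu]

theorem card_filter_notMem_and_le_shiftFamily {α : Type*} [DecidableEq α] (i j : α)
    (B : Finset (Finset α)) :
    #(B.filter fun A => i ∉ A ∧ j ∉ A) ≤ #((shiftFamily i j B).filter (i ∉ ·)) := by
  refine card_le_card fun A hA => ?_
  rw [mem_filter] at hA ⊢
  refine ⟨mem_image.2 ⟨A, hA.1, ?_⟩, hA.2.1⟩
  simp [shiftMember, shiftSet, hA.2.2]

theorem sum_shiftMember_le {n : ℕ} {i j : Fin n} (hij : i < j) (B : Finset (Finset (Fin n)))
    (A : Finset (Fin n)) : ∑ x ∈ shiftMember i j B A, (x : ℕ) ≤ ∑ x ∈ A, (x : ℕ) ∧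
      (shiftMember i j B A ≠ A → ∑ x ∈ shiftMember i j B A, (x : ℕ) < ∑ x ∈ A, (x : ℕ)) := by
  unfold shiftMember shiftSet
  split_ifs with h1 h2 h2
  all_goals try simp only [le_refl, ne_eq, not_true_eq_false, false_imp_iff, and_self]
  have h4 := sum_erase_add A (fun x : Fin n => (x : ℕ)) h1.1
  rw [sum_insert (by simp [h1.2])]
  have : (i : ℕ) < j := hij
  constructor
  · omega
  · intro; omega

/-- The decreasing measure that makes repeated shifting terminate. -/
theorem sum_shiftFamily_lt {n : ℕ} {i j : Fin n} (hij : i < j) {B : Finset (Finset (Fin n))}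
    {A : Finset (Fin n)} (hA : A ∈ B) (hj : j ∈ A) (hi : i ∉ A) (hs : insert i (A.erase j) ∉ B) :
    ∑ A ∈ shiftFamily i j B, ∑ x ∈ A, (x : ℕ) < ∑ A ∈ B, ∑ x ∈ A, (x : ℕ) := by
  rw [shiftFamily, sum_image (shiftMember_injOn i j B)]
  refine sum_lt_sum (fun A _ => (sum_shiftMember_le hij B A).1)
    ⟨A, hA, (sum_shiftMember_le hij B A).2 ?_⟩
  rw [shiftMember, shiftSet_of_mem hj hi, if_neg hs]
  intro h
  exact hi (h ▸ mem_insert_self _ _)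

/-! ### Shifted families and the reflection principle -/

/-- `B` is stable under replacing an element of `V` by a smaller element of `V`. -/
def IsShiftedOn {α : Type*} [LinearOrder α] (V : Finset α) (B : Finset (Finset α)) : Prop :=
  ∀ i ∈ V, ∀ j ∈ V, i < j → ∀ A ∈ B, j ∈ A → i ∉ A → insert i (A.erase j) ∈ B

theorem exists_card_filter_le_eq {α : Type*} [LinearOrder α] {t : ℕ} (S : Finset α) (ht : 1 ≤ t)
    (hS : t ≤ #S) : ∃ c ∈ S, #(S.filter (· ≤ c)) = t := by
  induction S using Finset.induction_on_max with
  | empty => simp at hS; omega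
  | insert a S ha ih =>
    have haS : a ∉ S := fun h => lt_irrefl _ (ha a h)
    rw [card_insert_of_notMem haS] at hS
    rcases hS.eq_or_lt with h | h
    · refine ⟨a, mem_insert_self _ _, ?_⟩
      rw [filter_true_of_mem, card_insert_of_notMem haS, h]
      intro x hx
      rcases mem_insert.1 hx with rfl | hx
      · exact le_rfl
      · exact (ha x hx).le
    · obtain ⟨c, hc, hc'⟩ := ih (by omega)
      refine ⟨c, mem_insert_of_mem hc, ?_⟩
      rw [filter_insert, if_neg (not_le.2 (ha c hc)), hc']

/-- Let `c` be the `t`-th common element. Unless `c` itself serves, some `i < c` in `V` lies in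
neither set, and replacing `c` by `i` in `A` shrinks the intersection while staying in `B`. -/
theorem exists_prefix_of_isShiftedOn {α : Type*} [LinearOrder α] {t : ℕ} {V A' : Finset α}
    {B : Finset (Finset α)} (ht : 1 ≤ t) (hB : IsShiftedOn V B) (hBV : ∀ A ∈ B, A ⊆ V)
    (hA' : A' ⊆ V) (hBA' : ∀ A ∈ B, t ≤ #(A ∩ A')) (A : Finset α) (hA : A ∈ B) :
    ∃ c, #(V.filter (· ≤ c)) + t ≤ #(A.filter (· ≤ c)) + #(A'.filter (· ≤ c)) := by
  induction h : #(A ∩ A') using Nat.strong_induction_on generalizing A with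
  | _ m ih =>
  by_contra! hcon
  obtain ⟨c, hc, hct⟩ := exists_card_filter_le_eq (A ∩ A') ht (hBA' A hA)
  rw [mem_inter] at hc
  have hAV := hBV A hA
  obtain ⟨i, hiV, hic, hiA, hiA'⟩ : ∃ i ∈ V, i ≤ c ∧ i ∉ A ∧ i ∉ A' := by
    by_contra! hno
    have h1 := card_union_add_card_inter (A.filter (· ≤ c)) (A'.filter (· ≤ c))
    rw [← filter_inter_distrib, hct] at h1
    have h2 : #(V.filter (· ≤ c)) ≤ #(A.filter (· ≤ c) ∪ A'.filter (· ≤ c)) := by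
      refine card_le_card fun i hi => ?_
      rw [mem_filter] at hi
      rw [← filter_union, mem_filter, mem_union]
      refine ⟨?_, hi.2⟩
      by_contra h3
      push Not at h3
      exact h3.2 (hno i hi.1 hi.2 h3.1)
    have := hcon c
    omega
  have hlt : i < c := lt_of_le_of_ne hic (fun h => hiA (h ▸ hc.1))
  have hnew := hB i hiV c (hAV hc.1) hlt A hA hc.1 hiA
  have hint : insert i (A.erase c) ∩ A' = (A ∩ A').erase c := by
    rw [insert_inter_of_notMem hiA', erase_inter]
  have hsub : insert i (A.erase c) ⊆ V := hBV _ hnew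
  obtain ⟨d, hd⟩ := ih _ (by
    rw [← h, hint]
    exact card_erase_lt_of_mem (mem_inter.2 hc)) _ hnew rfl
  -- Below `c` the new intersection has fewer than `t` elements, so `d < c` is impossible; from `c`
  -- on, the exchange does not change prefix counts of `A`.
  rcases lt_or_ge d c with hdc | hdc
  · have h1 := card_union_add_card_inter ((insert i (A.erase c)).filter (· ≤ d))
      (A'.filter (· ≤ d))
    rw [← filter_inter_distrib, ← filter_union, hint] at h1
    have h2 : #((insert i (A.erase c) ∪ A').filter (· ≤ d)) ≤ #(V.filter (· ≤ d)) :=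
      card_le_card (filter_subset_filter _ (union_subset hsub hA'))
    have h3 : #(((A ∩ A').erase c).filter (· ≤ d)) < #((A ∩ A').filter (· ≤ c)) := by
      refine card_lt_card ((ssubset_iff_of_subset ?_).2 ⟨c, ?_, ?_⟩)
      · intro x hx
        simp only [mem_filter, mem_erase] at hx ⊢
        exact ⟨hx.1.2, hx.2.trans hdc.le⟩
      · simp [hc]
      · simp
    omega
  · have h1 : #((insert i (A.erase c)).filter (· ≤ d)) = #(A.filter (· ≤ d)) := by
      rw [filter_insert, if_pos (hic.trans hdc), filter_erase,
        card_insert_of_notMem (by simp [hiA]), card_erase_add_one (mem_filter.2 ⟨hc.1, hdc⟩)]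
    have := hcon d
    omega

open scoped Classical in
/-- By the reflection principle, few sets exceed the half-density line by `t`. -/
theorem card_filter_exists_prefix_le {α : Type*} [LinearOrder α] (V : Finset α) (t r : ℕ)
    (ht : 1 ≤ t) :
    #((powersetCard (t + r) V).filter fun A =>
      ∃ c, #(V.filter (· ≤ c)) + t ≤ 2 * #(A.filter (· ≤ c))) ≤ (#V).choose r := by
  induction V using Finset.induction_on_min generalizing t r with
  | empty =>
    rw [filter_false_of_mem]
    · simp
    · intro A hA
      rw [mem_powersetCard, subset_empty] at hA
      obtain ⟨rfl, hA⟩ := hA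
      simp at hA
      omega
  | insert a V ha ih =>
    have haV : a ∉ V := fun h => lt_irrefl _ (ha a h)
    let H : ℕ → ℕ → Finset (Finset α) := fun t l => (powersetCard l V).filter fun A =>
      ∃ c, #(V.filter (· ≤ c)) + t ≤ 2 * #(A.filter (· ≤ c))
    -- Condition on the first step of the walk: up if `a ∈ A` (remaining level `t - 1`), down
    -- otherwise (level `t + 1`); the two bounds add by Pascal's rule. For `t = 1` the level left
    -- after an up-step is 0, and all `r`-sets are counted.
    have hH0 : #(H (t - 1) (t - 1 + r)) ≤ (#V).choose r := by
      rcases Nat.lt_or_ge t 2 with h | h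
      · obtain rfl : t = 1 := by omega
        refine (card_filter_le _ _).trans ?_
        rw [card_powersetCard, show 1 - 1 + r = r by omega]
      · exact ih (t - 1) r (by omega)
    have hsub : ((powersetCard (t + r) (insert a V)).filter fun A =>
        ∃ c, #((insert a V).filter (· ≤ c)) + t ≤ 2 * #(A.filter (· ≤ c))) ⊆
        (H (t - 1) (t - 1 + r)).image (insert a) ∪ H (t + 1) (t + r) := by
      intro A hA
      simp only [mem_filter, mem_powersetCard] at hA
      obtain ⟨⟨hAV, hAc⟩, c, hc⟩ := hA
      have hac : a ≤ c := by
        by_contra hac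
        have h1 : A.filter (· ≤ c) = ∅ := by
          rw [filter_eq_empty_iff]
          intro x hx hxc
          rcases mem_insert.1 (hAV hx) with rfl | hx
          · exact hac hxc
          · exact hac ((ha x hx).le.trans hxc)
        rw [h1] at hc
        simp at hc
        omega
      rw [filter_insert, if_pos hac, card_insert_of_notMem (by simp [haV])] at hc
      rw [mem_union]
      by_cases haA : a ∈ A
      · left
        refine mem_image.2 ⟨A.erase a, ?_, insert_erase haA⟩
        simp only [H, mem_filter, mem_powersetCard]
        refine ⟨⟨subset_insert_iff.1 hAV, ?_⟩, c, ?_⟩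
        · rw [card_erase_of_mem haA]; omega
        · rw [filter_erase, card_erase_of_mem (mem_filter.2 ⟨haA, hac⟩)]
          omega
      · right
        simp only [H, mem_filter, mem_powersetCard]
        exact ⟨⟨(subset_insert_iff_of_notMem haA).1 hAV, hAc⟩, c, by omega⟩
    refine (card_le_card hsub).trans ((card_union_le _ _).trans ?_)
    rw [card_insert_of_notMem haV]
    rcases Nat.eq_zero_or_pos r with rfl | hr
    · have : H (t + 1) (t + 0) = ∅ := by
        simp only [H]
        rw [filter_eq_empty_iff]
        rintro A hA ⟨c, hc⟩
        rw [mem_powersetCard] at hA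
        have h1 := card_le_card (filter_subset_filter (· ≤ c) hA.1)
        have h2 := card_le_card (filter_subset (· ≤ c) A)
        omega
      rw [this]
      have := card_image_le (s := H (t - 1) (t - 1 + 0)) (f := insert a)
      simp only [Nat.choose_zero_right, card_empty] at hH0 ⊢
      omega
    · obtain ⟨r, rfl⟩ : ∃ r', r = r' + 1 := ⟨r - 1, by omega⟩
      have h1 := ih (t + 1) r (by omega)
      rw [show t + 1 + r = t + (r + 1) by omega] at h1
      have h2 := card_image_le (s := H (t - 1) (t - 1 + (r + 1))) (f := insert a)
      rw [Nat.choose_succ_succ']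
      change #(H (t + 1) (t + (r + 1))) ≤ _ at h1
      omega

open scoped Classical in
/-- Of two cross `t`-intersecting families of `(t + r)`-sets, one of which is shifted, one has at
most `(#V).choose r` members. -/
theorem IsShiftedOn.card_le_or_card_le {α : Type*} [LinearOrder α] {V : Finset α} {t r : ℕ}
    {B C : Finset (Finset α)} (ht : 1 ≤ t) (hB : IsShiftedOn V B)
    (hBV : ∀ A ∈ B, A ⊆ V ∧ #A = t + r) (hCV : ∀ A ∈ C, A ⊆ V ∧ #A = t + r)
    (hBC : ∀ A ∈ B, ∀ A' ∈ C, t ≤ #(A ∩ A')) :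
    #B ≤ (#V).choose r ∨ #C ≤ (#V).choose r := by
  by_cases h : ∀ A ∈ B, ∃ c, #(V.filter (· ≤ c)) + t ≤ 2 * #(A.filter (· ≤ c))
  · left
    refine (card_le_card fun A hA => ?_).trans (card_filter_exists_prefix_le V t r ht)
    exact mem_filter.2 ⟨mem_powersetCard.2 (hBV A hA), h A hA⟩
  -- A member of `B` staying below the line forces, through the prefix inequality, every member of
  -- `C` above it.
  · right
    push Not at h
    obtain ⟨A, hA, hAc⟩ := h
    refine (card_le_card fun A' hA' => ?_).trans (card_filter_exists_prefix_le V t r ht)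
    refine mem_filter.2 ⟨mem_powersetCard.2 (hCV A' hA'), ?_⟩
    obtain ⟨c, hc⟩ := exists_prefix_of_isShiftedOn ht hB (fun S hS => (hBV S hS).1)
      (hCV A' hA').1 (fun S hS => hBC S hS A' hA') A hA
    exact ⟨c, by have := hAc c; omega⟩

end Shift

/-! ### Concentration of large cross-intersecting families -/

section Center

open Finset

theorem six_mul_choose_le {W a : ℕ} (ha : 1 ≤ a) (hW : 6 * a ≤ W) :
    6 * (W - 1).choose (a - 1) ≤ W.choose a := by
  obtain ⟨a, rfl⟩ : ∃ b, a = b + 1 := ⟨a - 1, by omega⟩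
  obtain ⟨W, rfl⟩ : ∃ b, W = b + 1 := ⟨W - 1, by omega⟩
  have h := Nat.add_one_mul_choose_eq W a
  simp only [Nat.add_sub_cancel]
  have h1 : 6 * (a + 1) * W.choose a ≤ (W + 1) * W.choose a := Nat.mul_le_mul_right _ hW
  refine Nat.le_of_mul_le_mul_right (c := a + 1) ?_ (by omega)
  rw [← h]
  linarith

theorem five_mul_choose_le {W a : ℕ} (ha : 1 ≤ a) (hW : 6 * a ≤ W) :
    5 * W.choose (a - 1) ≤ W.choose a := by
  obtain ⟨a, rfl⟩ : ∃ b, a = b + 1 := ⟨a - 1, by omega⟩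
  have h := Nat.choose_succ_right_eq W a
  simp only [Nat.add_sub_cancel]
  have h1 : W.choose a * (5 * (a + 1)) ≤ W.choose a * (W - a) :=
    Nat.mul_le_mul_left _ (by omega)
  refine Nat.le_of_mul_le_mul_right (c := a + 1) ?_ (by omega)
  rw [h]
  linarith

theorem choose_eq_add {W a : ℕ} (ha : 1 ≤ a) (hW : 1 ≤ W) :
    W.choose a = (W - 1).choose (a - 1) + (W - 1).choose a := by
  obtain ⟨a, rfl⟩ : ∃ b, a = b + 1 := ⟨a - 1, by omega⟩
  obtain ⟨W, rfl⟩ : ∃ b, W = b + 1 := ⟨W - 1, by omega⟩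
  exact Nat.choose_succ_succ' W a

theorem card_filter_eq_add {β : Type*} (B : Finset β) (p q : β → Prop) [DecidablePred p]
    [DecidablePred q] :
    #(B.filter p) = #(B.filter fun A => p A ∧ q A) + #(B.filter fun A => p A ∧ ¬ q A) := by
  rw [← filter_filter, ← filter_filter, card_filter_add_card_filter_not]

variable {α : Type*} [DecidableEq α]

theorem card_mem_add_card_notMem (B : Finset (Finset α)) (u : α) :
    #(B.filter (u ∈ ·)) + #(B.filter (u ∉ ·)) = #B :=
  card_filter_add_card_filter_not _

/-- Otherwise Kruskal-Katona with `j = 2` leaves at most `C(W,a) - C(W-2,a) = C(W-1,a-1) +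
C(W-2,a-1)` members of `B` through `u`, which is at most a third of `C(W,a)`. -/
theorem six_mul_card_notMem_lt {V : Finset α} {a W : ℕ} {B C : Finset (Finset α)} (ha : 1 ≤ a)
    (hW : 6 * a ≤ W) (hV : #V = W + 1) (hB : ∀ A ∈ B, A ⊆ V ∧ #A = a + 1)
    (hC : ∀ A ∈ C, A ⊆ V ∧ #A = a + 1) (hBC : ∀ A ∈ B, ∀ A' ∈ C, ¬ Disjoint A A') {u : α}
    (hu : u ∈ V) (h : W.choose a < 3 * #(B.filter (u ∈ ·))) :
    6 * #(C.filter (u ∉ ·)) < W.choose a := by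
  by_contra! hcon
  have h6 := six_mul_choose_le ha hW
  have hm : (W - 2).choose (a - 1) ≤ (W - 1).choose (a - 1) :=
    Nat.choose_le_choose _ (by omega)
  have := card_add_choose_le_of_cross_trace (a := a) (b := a + 1) (j := 2) (N := W) V {u} {u} ∅
    (B.filter (u ∈ ·)) (C.filter (u ∉ ·))
    (by
      intro A hA
      rw [mem_filter] at hA
      exact ⟨(hB A hA.1).1, (hB A hA.1).2, inter_singleton_of_mem hA.2⟩)
    (by
      intro A hA
      rw [mem_filter] at hA
      exact ⟨(hC A hA.1).1, (hC A hA.1).2, inter_singleton_of_notMem hA.2⟩)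
    (by simp) (by rw [card_sdiff_of_subset (by simpa using hu), hV]; simp)
    (fun A hA A' hA' => hBC A (mem_filter.1 hA).1 A' (mem_filter.1 hA').1)
    (by omega) (by omega) (by simp only [show a + 1 - 2 = a - 1 by omega]; omega)
  have e1 := choose_eq_add ha (show 1 ≤ W by omega)
  have e2 := choose_eq_add ha (show 1 ≤ W - 1 by omega)
  rw [show W - 1 - 1 = W - 2 by omega] at e2
  omega

theorem six_mul_card_swap_lt {V : Finset α} {a W : ℕ} {B C : Finset (Finset α)} (ha : 1 ≤ a)
    (hW : 6 * a ≤ W) (hV : #V = W + 1) (hB : ∀ A ∈ B, A ⊆ V ∧ #A = a + 1)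
    (hC : ∀ A ∈ C, A ⊆ V ∧ #A = a + 1) (hBC : ∀ A ∈ B, ∀ A' ∈ C, ¬ Disjoint A A') {i j : α}
    (hi : i ∈ V) (hj : j ∈ V) (hij : i ≠ j)
    (h : W.choose a < 6 * #(B.filter fun A => i ∈ A ∧ j ∉ A)) :
    6 * #(C.filter fun A => i ∉ A ∧ j ∈ A) < W.choose a := by
  by_contra! hcon
  have h6 := six_mul_choose_le ha hW
  have hm : (W - 2).choose (a - 1) ≤ (W - 1).choose (a - 1) :=
    Nat.choose_le_choose _ (by omega)
  have := card_add_choose_le_of_cross_trace (a := a) (b := a) (j := 1) (N := W - 1) V {i, j} {i}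
    {j} (B.filter fun A => i ∈ A ∧ j ∉ A) (C.filter fun A => i ∉ A ∧ j ∈ A)
    (by
      intro A hA
      rw [mem_filter] at hA
      refine ⟨(hB A hA.1).1, (hB A hA.1).2, ?_⟩
      rw [inter_insert_of_mem hA.2.1, inter_singleton_of_notMem hA.2.2, insert_empty])
    (by
      intro A hA
      rw [mem_filter] at hA
      refine ⟨(hC A hA.1).1, (hC A hA.1).2, ?_⟩
      rw [inter_insert_of_notMem hA.2.1, inter_singleton_of_mem hA.2.2])
    (by simpa using hij)
    (by
      rw [card_sdiff_of_subset (insert_subset hi (by simpa using hj)), hV, card_pair hij]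
      omega)
    (fun A hA A' hA' => hBC A (mem_filter.1 hA).1 A' (mem_filter.1 hA').1)
    (by omega) (by omega) (by rw [show W - 1 - 1 = W - 2 by omega]; omega)
  have e2 := choose_eq_add ha (show 1 ≤ W - 1 by omega)
  rw [show W - 1 - 1 = W - 2 by omega] at e2 this
  omega

theorem six_mul_card_notMem_lt_and {V : Finset α} {a W : ℕ} {B C : Finset (Finset α)} (ha : 1 ≤ a)
    (hW : 6 * a ≤ W) (hV : #V = W + 1) (hB : ∀ A ∈ B, A ⊆ V ∧ #A = a + 1)
    (hC : ∀ A ∈ C, A ⊆ V ∧ #A = a + 1) (hBC : ∀ A ∈ B, ∀ A' ∈ C, ¬ Disjoint A A')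
    (hCc : 2 * W.choose a < 3 * #C) {u : α}
    (hu : u ∈ V) (h : W.choose a < 3 * #(B.filter (u ∈ ·))) :
    6 * #(B.filter (u ∉ ·)) < W.choose a ∧ 6 * #(C.filter (u ∉ ·)) < W.choose a := by
  have h1 := six_mul_card_notMem_lt ha hW hV hB hC hBC hu h
  have h2 := card_mem_add_card_notMem C u
  exact ⟨six_mul_card_notMem_lt ha hW hV hC hB (fun A hA A' hA' hd => hBC A' hA' A hA hd.symm) hu
    (by omega), h1⟩

theorem card_eq_sum_traces (B : Finset (Finset α)) (i j : α) :
    #B = #(B.filter fun A => i ∈ A ∧ j ∈ A) + #(B.filter fun A => i ∈ A ∧ j ∉ A)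
      + #(B.filter fun A => i ∉ A ∧ j ∈ A) + #(B.filter fun A => i ∉ A ∧ j ∉ A) := by
  rw [← card_mem_add_card_notMem B i, card_filter_eq_add B (i ∈ ·) (j ∈ ·),
    card_filter_eq_add B (i ∉ ·) (j ∈ ·), add_assoc, add_assoc, add_assoc]

theorem six_mul_card_pair_le {V : Finset α} {a W : ℕ} {B : Finset (Finset α)} (ha : 1 ≤ a)
    (hW : 6 * a ≤ W) (hV : #V = W + 1) (hB : ∀ A ∈ B, A ⊆ V ∧ #A = a + 1) {i j : α}
    (hi : i ∈ V) (hj : j ∈ V) (hij : i ≠ j) :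
    6 * #(B.filter fun A => i ∈ A ∧ j ∈ A) ≤ W.choose a := by
  have h6 := six_mul_choose_le ha hW
  have := card_le_choose_of_trace (a := a + 1) (V := V) (Q := {i, j}) (Q₁ := {i, j})
    (B.filter fun A => i ∈ A ∧ j ∈ A) (by
      intro A hA
      rw [mem_filter] at hA
      refine ⟨(hB A hA.1).1, (hB A hA.1).2, ?_⟩
      rw [inter_insert_of_mem hA.2.1, inter_singleton_of_mem hA.2.2])
  rw [card_sdiff_of_subset (insert_subset hi (by simpa using hj)), hV, card_pair hij,
    show W + 1 - 2 = W - 1 by omega, show a + 1 - 2 = a - 1 by omega] at this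
  omega

/-- Used to undo a shift whose centre is `i`. In units of `C(W,a)/6`, the traces `{j}`, `{i,j}` and
`∅` of `C` total less than 3 of its more than 4, so trace `{i}` has more than 1; this makes trace
`{j}` of `B` small in turn, leaving `B` more than 2 through `i`. -/
theorem six_mul_card_notMem_lt_of_shift {V : Finset α} {a W : ℕ} {B C : Finset (Finset α)}
    (ha : 1 ≤ a) (hW : 6 * a ≤ W) (hV : #V = W + 1) (hB : ∀ A ∈ B, A ⊆ V ∧ #A = a + 1)
    (hC : ∀ A ∈ C, A ⊆ V ∧ #A = a + 1) (hBC : ∀ A ∈ B, ∀ A' ∈ C, ¬ Disjoint A A')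
    (hBc : 2 * W.choose a < 3 * #B) (hCc : 2 * W.choose a < 3 * #C) {i j : α}
    (hi : i ∈ V) (hj : j ∈ V) (hij : i ≠ j)
    (hBE : 6 * #(B.filter fun A => i ∉ A ∧ j ∉ A) < W.choose a)
    (hCE : 6 * #(C.filter fun A => i ∉ A ∧ j ∉ A) < W.choose a)
    (h : W.choose a < 6 * #(B.filter fun A => i ∈ A ∧ j ∉ A)) :
    6 * #(B.filter (i ∉ ·)) < W.choose a ∧ 6 * #(C.filter (i ∉ ·)) < W.choose a := by
  have hC2 := six_mul_card_swap_lt ha hW hV hB hC hBC hi hj hij h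
  have hCP := six_mul_card_pair_le ha hW hV hC hi hj hij
  have hCs := card_eq_sum_traces C i j
  have hB2 := six_mul_card_swap_lt ha hW hV hC hB
    (fun A hA A' hA' hd => hBC A' hA' A hA hd.symm) hi hj hij (by omega)
  refine six_mul_card_notMem_lt_and ha hW hV hB hC hBC hCc hi ?_
  have h1 := card_mem_add_card_notMem B i
  rw [card_filter_eq_add B (i ∉ ·) (j ∈ ·)] at h1
  omega

end Center

open Finset in
/-- Two large cross-intersecting families are both concentrated on a common star. -/
theorem exists_common_center {n a W : ℕ} {V : Finset (Fin n)} {B C : Finset (Finset (Fin n))}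
    (ha : 1 ≤ a) (hW : 6 * a ≤ W) (hV : #V = W + 1) (hB : ∀ A ∈ B, A ⊆ V ∧ #A = a + 1)
    (hC : ∀ A ∈ C, A ⊆ V ∧ #A = a + 1) (hBC : ∀ A ∈ B, ∀ A' ∈ C, ¬ Disjoint A A')
    (hBc : 2 * W.choose a < 3 * #B) (hCc : 2 * W.choose a < 3 * #C) :
    ∃ u ∈ V, 6 * #(B.filter (u ∉ ·)) < W.choose a ∧ 6 * #(C.filter (u ∉ ·)) < W.choose a := by
  induction hm : ∑ A ∈ B, ∑ x ∈ A, (x : ℕ) using Nat.strong_induction_on generalizing B C with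
  | _ m ih =>
  have hCB : ∀ A ∈ C, ∀ A' ∈ B, ¬ Disjoint A A' := fun A hA A' hA' hd => hBC A' hA' A hA hd.symm
  by_cases hs : IsShiftedOn V B
  · have hne : V.Nonempty := card_pos.1 (by omega)
    set v := V.min' hne
    have hv : v ∈ V := V.min'_mem hne
    have h5 := five_mul_choose_le ha hW
    have hvlt : ∀ j ∈ V, j ≠ v → v < j := fun j hj hjv =>
      lt_of_le_of_ne (V.min'_le j hj) hjv.symm
    have hsub : ∀ X : Finset (Finset (Fin n)), (∀ A ∈ X, A ⊆ V ∧ #A = a + 1) →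
        ∀ A ∈ X.filter (v ∉ ·), A ⊆ V.erase v ∧ #A = 2 + (a - 1) := by
      intro X hX A hA
      rw [mem_filter] at hA
      exact ⟨subset_erase.2 ⟨(hX A hA.1).1, hA.2⟩, by rw [(hX A hA.1).2]; omega⟩
    have hs' : IsShiftedOn (V.erase v) (B.filter (v ∉ ·)) := by
      intro i hi j hj hij A hA hjA hiA
      rw [mem_filter] at hA ⊢
      refine ⟨hs i (mem_of_mem_erase hi) j (mem_of_mem_erase hj) hij A hA.1 hjA hiA, ?_⟩
      rw [mem_insert, mem_erase]
      rintro (h | h)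
      · exact (mem_erase.1 hi).1 h.symm
      · exact hA.2 h.2
    -- If `j` were the only common point, exchanging it for `v` in `A` would give a member of `B`
    -- disjoint from `A'`.
    have h2 : ∀ A ∈ B.filter (v ∉ ·), ∀ A' ∈ C.filter (v ∉ ·), 2 ≤ #(A ∩ A') := by
      intro A hA A' hA'
      rw [mem_filter] at hA hA'
      by_contra! hlt
      obtain ⟨j, hj, hj'⟩ := not_disjoint_iff.1 (hBC A hA.1 A' hA'.1)
      have hjV := (hB A hA.1).1 hj
      have hjv : j ≠ v := fun h => hA.2 (h ▸ hj)
      refine hBC _ (hs v hv j hjV (hvlt j hjV hjv) A hA.1 hj hA.2) A' hA'.1 ?_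
      rw [disjoint_insert_left]
      refine ⟨hA'.2, Finset.disjoint_left.2 fun x hx hx' => (mem_erase.1 hx).1 ?_⟩
      exact card_le_one.1 (by omega) x (mem_inter.2 ⟨(mem_erase.1 hx).2, hx'⟩) j
        (mem_inter.2 ⟨hj, hj'⟩)
    have hW' : #(V.erase v) = W := by rw [card_erase_of_mem hv, hV]; omega
    have e1 := card_mem_add_card_notMem B v
    have e2 := card_mem_add_card_notMem C v
    have hpos : 0 < W.choose a := Nat.choose_pos (by omega)
    -- One of the parts avoiding `v` has at most `C(W,a-1) ≤ C(W,a)/5` members, so that family keeps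
    -- more than `2/3 - 1/5 > 1/3` of `C(W,a)` through `v`.
    rcases hs'.card_le_or_card_le (by omega) (hsub B hB) (hsub C hC) h2 with h | h
    · rw [hW'] at h
      exact ⟨v, hv, six_mul_card_notMem_lt_and ha hW hV hB hC hBC hCc hv (by omega)⟩
    · rw [hW'] at h
      exact ⟨v, hv, (six_mul_card_notMem_lt_and ha hW hV hC hB hCB hBc hv (by omega)).symm⟩
  · unfold IsShiftedOn at hs
    push Not at hs
    obtain ⟨i, hi, j, hj, hij, A, hA, hjA, hiA, hAB⟩ := hs
    obtain ⟨u, hu, hu1, hu2⟩ := ih _ (hm ▸ sum_shiftFamily_lt hij hA hjA hiA hAB)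
      (shiftFamily_sized hi hB) (shiftFamily_sized hi hC) (shiftFamily_cross i j hBC)
      (by rwa [card_shiftFamily]) (by rwa [card_shiftFamily]) rfl
    -- A centre `i` after the shift may have been `i` or `j` before it: few members miss both and
    -- few contain both, so in `B` one of the two singleton traces is large.
    by_cases hui : u = i
    · subst hui
      have hBE := card_filter_notMem_and_le_shiftFamily u j B
      have hCE := card_filter_notMem_and_le_shiftFamily u j C
      have hBP := six_mul_card_pair_le ha hW hV hB hu hj hij.ne
      have hBs := card_eq_sum_traces B u j
      by_cases h : W.choose a < 6 * #(B.filter fun A => u ∈ A ∧ j ∉ A)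
      · exact ⟨u, hu, six_mul_card_notMem_lt_of_shift ha hW hV hB hC hBC hBc hCc hu hj hij.ne
          (by omega) (by omega) h⟩
      · refine ⟨j, hj, six_mul_card_notMem_lt_of_shift ha hW hV hB hC hBC hBc hCc hj hu hij.ne'
          ?_ ?_ ?_⟩
        · simp only [and_comm (a := j ∉ _)]
          omega
        · simp only [and_comm (a := j ∉ _)]
          omega
        · simp only [and_comm (a := j ∈ _)]
          omega
    · have h1 := card_filter_notMem_le_shiftFamily j B hui
      have h2 := card_filter_notMem_le_shiftFamily j C hui
      exact ⟨u, hu, by omega, by omega⟩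

/-! ### From degrees to the contradiction -/

section Degree

open Finset

theorem choose_le_choose_right_of_le_half {r s T : ℕ} (hrs : r ≤ s) (hs : 2 * s ≤ T) :
    T.choose r ≤ T.choose s := by
  induction s, hrs using Nat.le_induction with
  | base => exact le_rfl
  | succ s _ ih => exact (ih (by omega)).trans (Nat.choose_le_succ_of_lt_half_left (by omega))

theorem choose_le_choose_sub_one {k j N : ℕ} (hj : 3 ≤ j) (hjk : j < k) (hN : 6 * k ≤ N + 11) :
    (N - j).choose (k - j) ≤ (N - (j + 1)).choose (k - 2) := by
  obtain ⟨T, hT⟩ : ∃ T, N - j = T + 1 := ⟨N - j - 1, by omega⟩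
  rw [show N - (j + 1) = T by omega, hT]
  obtain ⟨r, hr⟩ : ∃ r, k - j = r + 1 := ⟨k - j - 1, by omega⟩
  rw [hr, Nat.choose_succ_succ']
  have h1 : T.choose r ≤ T.choose (k - 3) := choose_le_choose_right_of_le_half (by omega) (by omega)
  have h2 : T.choose (r + 1) ≤ T.choose (k - 3) :=
    choose_le_choose_right_of_le_half (by omega) (by omega)
  have h3 := Nat.choose_succ_right_eq T (k - 3)
  rw [show k - 3 + 1 = k - 2 by omega] at h3
  have h4 : T.choose (k - 3) * (2 * (k - 2)) ≤ T.choose (k - 3) * (T - (k - 3)) :=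
    Nat.mul_le_mul_left _ (by omega)
  have h5 : 2 * T.choose (k - 3) ≤ T.choose (k - 2) := by
    refine Nat.le_of_mul_le_mul_right (c := k - 2) ?_ (by omega)
    rw [h3]
    linarith
  omega

/-- The ratio is `(W-a)(W-a-1) / (W(W-1))`, which equals `2/3` at `a = 1`, `W = 6`. -/
theorem two_mul_choose_le {W a : ℕ} (ha : 1 ≤ a) (hW : 6 * a ≤ W) :
    2 * W.choose a ≤ 3 * (W - 2).choose a := by
  obtain ⟨d, rfl⟩ : ∃ d, W = 6 * a + d := ⟨W - 6 * a, by omega⟩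
  have h1 := Nat.choose_mul_succ_eq (6 * a + d - 1) a
  have h2 := Nat.choose_mul_succ_eq (6 * a + d - 2) a
  rw [show 6 * a + d - 1 + 1 = 6 * a + d by omega, show 6 * a + d - a = 5 * a + d by omega] at h1
  rw [show 6 * a + d - 2 + 1 = 6 * a + d - 1 by omega,
    show 6 * a + d - 1 - a = 5 * a + d - 1 by omega] at h2
  set p := (6 * a + d).choose a
  set q := (6 * a + d - 1).choose a
  set r := (6 * a + d - 2).choose a
  obtain ⟨b, rfl⟩ : ∃ b, a = b + 1 := ⟨a - 1, by omega⟩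
  rw [show 6 * (b + 1) + d - 1 = 6 * b + d + 5 by omega,
    show 5 * (b + 1) + d - 1 = 5 * b + d + 4 by omega] at h2
  have h3 : r * ((6 * b + d + 5) * (6 * (b + 1) + d)) =
      p * ((5 * (b + 1) + d) * (5 * b + d + 4)) := by
    calc _ = (r * (6 * b + d + 5)) * (6 * (b + 1) + d) := by ring
      _ = (q * (6 * (b + 1) + d)) * (5 * b + d + 4) := by rw [h2]; ring
      _ = _ := by rw [h1]; ring
  refine Nat.le_of_mul_le_mul_right (c := (6 * b + d + 5) * (6 * (b + 1) + d)) ?_ (by positivity)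
  have h4 : 2 * ((6 * b + d + 5) * (6 * (b + 1) + d)) ≤
      3 * ((5 * (b + 1) + d) * (5 * b + d + 4)) := by nlinarith
  calc _ = p * (2 * ((6 * b + d + 5) * (6 * (b + 1) + d))) := by ring
    _ ≤ p * (3 * ((5 * (b + 1) + d) * (5 * b + d + 4))) := Nat.mul_le_mul_left _ h4
    _ = 3 * (r * ((6 * b + d + 5) * (6 * (b + 1) + d))) := by rw [h3]; ring
    _ = _ := by ring

theorem card_filter_le_add {β : Type*} (F : Finset β) (p q r : β → Prop) [DecidablePred p]
    [DecidablePred q] [DecidablePred r] (h : ∀ A, p A → q A ∨ r A) :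
    #(F.filter p) ≤ #(F.filter q) + #(F.filter r) := by
  classical
  refine (card_le_card ?_).trans (card_union_le _ _)
  rw [← filter_or]
  exact monotone_filter_right _ fun A _ => h A

variable {n k : ℕ} {F : Finset (Finset (Fin n))}

theorem card_both_add_choose_le (hk : 3 ≤ k) (hn : 6 * k ≤ n + 9) (hF : ∀ A ∈ F, #A = k)
    (hint : ∀ A ∈ F, ∀ B ∈ F, ¬ Disjoint A B) {x y : Fin n} (hxy : x ≠ y) {j : ℕ} (hj : j ≤ k)
    (h : (n - 2 - j).choose (k - j) ≤ #(F.filter fun A => x ∉ A ∧ y ∉ A)) :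
    #(F.filter fun A => x ∈ A ∧ y ∈ A) + (n - 2 - j).choose (k - 2) ≤ (n - 2).choose (k - 2) := by
  refine card_add_choose_le_of_cross_trace (b := k) univ {x, y} {x, y} ∅
    (F.filter fun A => x ∈ A ∧ y ∈ A) (F.filter fun A => x ∉ A ∧ y ∉ A) ?_ ?_ (by simp) ?_
    (fun A hA A' hA' => hint A (mem_filter.1 hA).1 A' (mem_filter.1 hA').1) hj (by omega) h
  · intro A hA
    rw [mem_filter] at hA
    refine ⟨subset_univ _, ?_, ?_⟩
    · rw [hF A hA.1, card_pair hxy]; omega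
    · rw [inter_insert_of_mem hA.2.1, inter_singleton_of_mem hA.2.2]
  · intro A hA
    rw [mem_filter] at hA
    refine ⟨subset_univ _, hF A hA.1, ?_⟩
    rw [inter_insert_of_notMem hA.2.1, inter_singleton_of_notMem hA.2.2]
  · rw [card_sdiff_of_subset (subset_univ _), card_pair hxy, card_univ, Fintype.card_fin]

/-- Locate the "neither" count between consecutive values `C(n-2-j,k-j)`: Kruskal-Katona at the
lower one removes from "both" at least the upper one, by `choose_le_choose_sub_one`. -/
theorem card_both_add_card_neither_le (hk : 3 ≤ k) (hn : 6 * k ≤ n + 9) (hF : ∀ A ∈ F, #A = k)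
    (hint : ∀ A ∈ F, ∀ B ∈ F, ¬ Disjoint A B) {x y : Fin n} (hxy : x ≠ y)
    (h : #(F.filter fun A => x ∉ A ∧ y ∉ A) ≤ (n - 5).choose (k - 2)) :
    #(F.filter fun A => x ∈ A ∧ y ∈ A) + #(F.filter fun A => x ∉ A ∧ y ∉ A) ≤
      (n - 2).choose (k - 2) := by
  have key := fun j => card_both_add_choose_le (j := j) hk hn hF hint hxy
  have small : ∀ d j, j + d = k → 3 ≤ j →
      #(F.filter fun A => x ∉ A ∧ y ∉ A) < (n - 2 - j).choose (k - j) →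
      #(F.filter fun A => x ∈ A ∧ y ∈ A) + #(F.filter fun A => x ∉ A ∧ y ∉ A) ≤
      (n - 2).choose (k - 2) := by
    intro d
    induction d with
    | zero =>
      intro j hj _ hlt
      rw [show j = k from hj, Nat.sub_self, Nat.choose_zero_right] at hlt
      have := card_le_choose_of_trace (a := k) (V := univ) (Q := {x, y}) (Q₁ := {x, y})
        (F.filter fun A => x ∈ A ∧ y ∈ A) (by
          intro A hA
          rw [mem_filter] at hA
          refine ⟨subset_univ _, hF A hA.1, ?_⟩
          rw [inter_insert_of_mem hA.2.1, inter_singleton_of_mem hA.2.2])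
      rw [card_sdiff_of_subset (subset_univ _), card_pair hxy, card_univ, Fintype.card_fin] at this
      omega
    | succ d ih =>
      intro j hj hj3 hlt
      by_cases hc : (n - 2 - (j + 1)).choose (k - (j + 1)) ≤ #(F.filter fun A => x ∉ A ∧ y ∉ A)
      · have h1 := key (j + 1) (by omega) hc
        have h2 := choose_le_choose_sub_one (N := n - 2) hj3 (by omega : j < k) (by omega)
        omega
      · exact ih (j + 1) (by omega) (by omega) (by omega)
  by_cases hc : (n - 2 - 3).choose (k - 3) ≤ #(F.filter fun A => x ∉ A ∧ y ∉ A)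
  · have h1 := key 3 hk hc
    rw [show n - 2 - 3 = n - 5 by omega] at h1
    omega
  · exact small (k - 3) 3 (by omega) le_rfl (by omega)

theorem sum_card_filter_mem_eq (G : Finset (Finset (Fin n))) (D : Finset (Fin n)) :
    ∑ y ∈ D, #(G.filter (y ∈ ·)) = ∑ A ∈ G, #(D.filter (· ∈ A)) := by
  simp only [card_filter]
  exact sum_comm

theorem sum_card_filter_notMem_eq (G : Finset (Finset (Fin n))) (D : Finset (Fin n)) :
    ∑ y ∈ D, #(G.filter (y ∉ ·)) = ∑ A ∈ G, #(D.filter (· ∉ A)) := by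
  simp only [card_filter]
  exact sum_comm

theorem choose_lt_card_notMem_mem (hk : 3 ≤ k) (hn : 6 * k ≤ n + 9) (hF : ∀ A ∈ F, #A = k)
    (hint : ∀ A ∈ F, ∀ B ∈ F, ¬ Disjoint A B) {D : Finset (Fin n)} (hD : #D = 2 * k + 1)
    (hdeg : ∀ y ∈ D, (n - 2).choose (k - 2) < #(F.filter (y ∈ ·))) {x y : Fin n} (hy : y ∈ D)
    (hxy : x ≠ y) : (n - 5).choose (k - 2) < #(F.filter fun A => x ∉ A ∧ y ∈ A) := by
  have hsplit : ∀ y ∈ D, (n - 2).choose (k - 2) <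
      #(F.filter fun A => x ∈ A ∧ y ∈ A) + #(F.filter fun A => x ∉ A ∧ y ∈ A) := by
    intro y hy
    have h := hdeg y hy
    rw [card_filter_eq_add F (y ∈ ·) (x ∈ ·)] at h
    simpa only [and_comm (a := y ∈ _)] using h
  have hlarge : ∀ y ∈ D, x ≠ y → (n - 5).choose (k - 2) < #(F.filter fun A => x ∉ A ∧ y ∉ A) →
      (n - 5).choose (k - 2) < #(F.filter fun A => x ∉ A ∧ y ∈ A) := by
    intro y hy hxy h
    have hm : (n - 2 - 3).choose (k - 3) ≤ (n - 5).choose (k - 2) := by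
      rw [show n - 2 - 3 = n - 5 by omega]
      exact choose_le_choose_right_of_le_half (by omega) (by omega)
    have h1 := card_both_add_choose_le (j := 3) hk hn hF hint hxy hk (by omega)
    rw [show n - 2 - 3 = n - 5 by omega] at h1
    have h2 := hsplit y hy
    omega
  -- Otherwise, for each `z` in `D \ {x}`, more members avoiding `x` contain `z` than miss it. But
  -- `D \ {x}` has at least `2k` points, so each such member misses at least as many of them as it
  -- contains.
  obtain ⟨z, hz, hxz, hzc⟩ : ∃ z ∈ D, x ≠ z ∧
      (n - 5).choose (k - 2) < #(F.filter fun A => x ∉ A ∧ z ∉ A) := by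
    by_contra! hcon
    set G := F.filter (x ∉ ·)
    have hlt : ∑ z ∈ D.erase x, #(G.filter (z ∉ ·)) < ∑ z ∈ D.erase x, #(G.filter (z ∈ ·)) := by
      refine sum_lt_sum_of_nonempty ⟨y, mem_erase.2 ⟨hxy.symm, hy⟩⟩ fun z hz => ?_
      rw [mem_erase] at hz
      have h1 := card_both_add_card_neither_le hk hn hF hint hz.1.symm (hcon z hz.2 hz.1.symm)
      have h2 := hsplit z hz.2
      simp only [G, filter_filter]
      omega
    refine absurd hlt (not_lt.2 ?_)
    rw [sum_card_filter_mem_eq, sum_card_filter_notMem_eq]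
    refine sum_le_sum fun A hA => ?_
    have h1 : #((D.erase x).filter (· ∈ A)) + #((D.erase x).filter (· ∉ A)) = #(D.erase x) :=
      card_filter_add_card_filter_not _
    have h2 : #((D.erase x).filter (· ∈ A)) ≤ k := by
      rw [← hF A (mem_filter.1 hA).1]
      exact card_le_card fun i hi => (mem_filter.1 hi).2
    have h3 := pred_card_le_card_erase (s := D) (a := x)
    omega
  -- Both traces at `z` are large, so more than `2 C(n-5,k-2)` members avoid `x`; for any `y`, one
  -- of its two traces is then large.
  have h1 := card_filter_eq_add F (x ∉ ·) (z ∈ ·)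
  have h2 := card_filter_eq_add F (x ∉ ·) (y ∈ ·)
  have h3 := hlarge z hz hxz hzc
  by_cases h : (n - 5).choose (k - 2) < #(F.filter fun A => x ∉ A ∧ y ∉ A)
  · exact hlarge y hy hxy h
  · omega

theorem exists_center_of_pair (hk : 3 ≤ k) (hn : 6 * k ≤ n + 9) (hF : ∀ A ∈ F, #A = k)
    (hint : ∀ A ∈ F, ∀ B ∈ F, ¬ Disjoint A B) {x y : Fin n} (hxy : x ≠ y)
    (h₁ : (n - 5).choose (k - 2) < #(F.filter fun A => x ∉ A ∧ y ∈ A))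
    (h₂ : (n - 5).choose (k - 2) < #(F.filter fun A => y ∉ A ∧ x ∈ A)) :
    ∃ u, u ≠ x ∧ u ≠ y ∧
      6 * #(F.filter fun A => x ∈ A ∧ y ∉ A ∧ u ∉ A) < (n - 3).choose (k - 2) := by
  have h23 := two_mul_choose_le (W := n - 3) (a := k - 2) (by omega) (by omega)
  rw [show n - 3 - 2 = n - 5 by omega] at h23
  let V : Finset (Fin n) := univ \ {x, y}
  have hV : #V = (n - 3) + 1 := by
    rw [card_sdiff_of_subset (subset_univ _), card_pair hxy, card_univ, Fintype.card_fin]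
    omega
  have hinj : ∀ z, Set.InjOn (fun A : Finset (Fin n) => A.erase z) {A | z ∈ A} := by
    intro z A hA B hB h
    rw [← insert_erase (show z ∈ A from hA), show A.erase z = B.erase z from h,
      insert_erase (show z ∈ B from hB)]
  let L : Fin n → Fin n → Finset (Finset (Fin n)) := fun v w =>
    (F.filter fun A => w ∉ A ∧ v ∈ A).image (fun A => A.erase v)
  have hLc : ∀ v w, #(L v w) = #(F.filter fun A => w ∉ A ∧ v ∈ A) := fun v w =>
    card_image_of_injOn ((hinj v).mono fun A hA => (mem_filter.1 hA).2.2)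
  have hLs : ∀ v w, ∀ A ∈ L v w, v ∉ A ∧ w ∉ A ∧ #A = k - 2 + 1 := by
    intro v w A hA
    obtain ⟨A', hA', rfl⟩ := mem_image.1 hA
    rw [mem_filter] at hA'
    refine ⟨by simp, by simp [hA'.2.1], ?_⟩
    rw [card_erase_of_mem hA'.2.2, hF A' hA'.1]
    omega
  obtain ⟨u, hu, hu1, -⟩ := exists_common_center (V := V) (B := L x y) (C := L y x) (W := n - 3)
    (a := k - 2) (by omega) (by omega) hV
    (by
      intro A hA
      obtain ⟨h1, h2, h3⟩ := hLs x y A hA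
      refine ⟨fun z hz => ?_, h3⟩
      simp only [V, mem_sdiff, mem_univ, true_and, mem_insert, mem_singleton]
      rintro (rfl | rfl) <;> contradiction)
    (by
      intro A hA
      obtain ⟨h1, h2, h3⟩ := hLs y x A hA
      refine ⟨fun z hz => ?_, h3⟩
      simp only [V, mem_sdiff, mem_univ, true_and, mem_insert, mem_singleton]
      rintro (rfl | rfl) <;> contradiction)
    (by
      intro A hA A' hA' hd
      obtain ⟨S, hS, rfl⟩ := mem_image.1 hA
      obtain ⟨S', hS', rfl⟩ := mem_image.1 hA'
      rw [mem_filter] at hS hS'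
      refine hint S hS.1 S' hS'.1 ?_
      rw [Finset.disjoint_left] at hd ⊢
      intro z hz hz'
      exact hd (mem_erase.2 ⟨fun h => hS'.2.1 (h ▸ hz'), hz⟩)
        (mem_erase.2 ⟨fun h => hS.2.1 (h ▸ hz), hz'⟩))
    (by rw [hLc]; omega) (by rw [hLc]; omega)
  simp only [V, mem_sdiff, mem_univ, true_and, mem_insert, mem_singleton, not_or] at hu
  refine ⟨u, hu.1, hu.2, lt_of_le_of_lt (Nat.mul_le_mul_left 6 ?_) hu1⟩
  refine card_le_card_of_injOn (fun A => A.erase x) ?_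
    ((hinj x).mono fun A hA => (mem_filter.1 hA).2.1)
  intro A hA
  rw [mem_coe, mem_filter] at hA ⊢
  refine ⟨mem_image.2 ⟨A, mem_filter.2 ⟨hA.1, hA.2.2.1, hA.2.1⟩, rfl⟩, ?_⟩
  simp [hA.2.2.2]

theorem six_mul_card_triple_le (hk : 3 ≤ k) (hn : 6 * k ≤ n + 9) (hF : ∀ A ∈ F, #A = k)
    {x p q y : Fin n} (hxp : x ≠ p) (hxq : x ≠ q) (hpq : p ≠ q) (hxy : x ≠ y) (hpy : p ≠ y)
    (hqy : q ≠ y) :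
    6 * #(F.filter fun A => x ∈ A ∧ p ∈ A ∧ q ∈ A ∧ y ∉ A) ≤ (n - 3).choose (k - 2) := by
  have h6 := six_mul_choose_le (W := n - 3) (a := k - 2) (by omega) (by omega)
  have := card_le_choose_of_trace (a := k) (V := univ) (Q := {x, p, q, y}) (Q₁ := {x, p, q})
    (F.filter fun A => x ∈ A ∧ p ∈ A ∧ q ∈ A ∧ y ∉ A) (by
      intro A hA
      rw [mem_filter] at hA
      obtain ⟨h0, h1, h2, h3, h4⟩ := hA
      refine ⟨subset_univ _, hF A h0, ?_⟩
      rw [inter_insert_of_mem h1, inter_insert_of_mem h2, inter_insert_of_mem h3,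
        inter_singleton_of_notMem h4, insert_empty])
  rw [card_sdiff_of_subset (subset_univ _), card_univ, Fintype.card_fin,
    card_eq_three.2 ⟨x, p, q, hxp, hxq, hpq, rfl⟩, card_insert_of_notMem (by simp [*]),
    card_eq_three.2 ⟨p, q, y, hpq, hpy, hqy, rfl⟩] at this
  rw [show n - 3 - 1 = n - (3 + 1) by omega, show k - 2 - 1 = k - 3 by omega] at h6
  omega

/-- At most `2k` vertices of an intersecting family of `k`-sets have degree exceeding that of the
non-central vertices of a full star. -/
theorem exists_card_filter_mem_le (hk : 3 ≤ k) (hn : 6 * k ≤ n + 9) (hF : ∀ A ∈ F, #A = k)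
    (hint : ∀ A ∈ F, ∀ B ∈ F, ¬ Disjoint A B) {D : Finset (Fin n)} (hD : #D = 2 * k + 1) :
    ∃ y ∈ D, #(F.filter (y ∈ ·)) ≤ (n - 2).choose (k - 2) := by
  by_contra! hdeg
  have hbig := fun x y => choose_lt_card_notMem_mem (x := x) (y := y) hk hn hF hint hD hdeg
  have hcen : ∀ x ∈ D, ∀ y ∈ D, x ≠ y → ∃ u, u ≠ x ∧ u ≠ y ∧
      6 * #(F.filter fun A => x ∈ A ∧ y ∉ A ∧ u ∉ A) < (n - 3).choose (k - 2) :=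
    fun x hx y hy hxy => exists_center_of_pair hk hn hF hint hxy (hbig x y hy hxy)
      (hbig y x hx hxy.symm)
  have h23 := two_mul_choose_le (W := n - 3) (a := k - 2) (by omega) (by omega)
  rw [show n - 3 - 2 = n - 5 by omega] at h23
  obtain ⟨x, hx, y, hy, hxy⟩ := one_lt_card.1 (show 1 < #D by omega)
  obtain ⟨u, hux, huy, hu⟩ := hcen x hx y hy hxy
  obtain ⟨z, hz, hz'⟩ := exists_mem_notMem_of_card_lt_card
    (show #({x, y, u} : Finset (Fin n)) < #D from card_le_three.trans_lt (by omega))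
  simp only [mem_insert, mem_singleton, not_or] at hz'
  obtain ⟨hzx, hzy, hzu⟩ := hz'
  obtain ⟨v, hvx, hvz, hv⟩ := hcen x hx z hz (Ne.symm hzx)
  -- Distinct centres would cover the members with `x` but not `y` by four classes of at most `M/6`
  -- each, some strictly smaller, where `M = C(n-3,k-2)`; yet there are more than `2M/3`.
  have hvu : v = u := by
    by_contra hvu
    have h1 := hbig y x hx hxy.symm
    have h2 := card_filter_le_add F (fun A => y ∉ A ∧ x ∈ A)
      (fun A => x ∈ A ∧ y ∉ A ∧ u ∉ A) (fun A => x ∈ A ∧ y ∉ A ∧ u ∈ A) (by tauto)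
    have h3 := card_filter_le_add F (fun A => x ∈ A ∧ y ∉ A ∧ u ∈ A)
      (fun A => x ∈ A ∧ u ∈ A ∧ z ∈ A ∧ y ∉ A) (fun A => x ∈ A ∧ y ∉ A ∧ u ∈ A ∧ z ∉ A) (by tauto)
    have h4 := six_mul_card_triple_le hk hn hF (Ne.symm hux) (Ne.symm hzx) (Ne.symm hzu) hxy huy hzy
    have h5 := card_filter_le_add F (fun A => x ∈ A ∧ y ∉ A ∧ u ∈ A ∧ z ∉ A)
      (fun A => x ∈ A ∧ z ∉ A ∧ v ∉ A) (fun A => x ∈ A ∧ u ∈ A ∧ v ∈ A ∧ y ∉ A) (by tauto)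
    by_cases hvy : v = y
    · rw [hvy] at h5 hv
      have h6 : #(F.filter fun A => x ∈ A ∧ u ∈ A ∧ y ∈ A ∧ y ∉ A) = 0 := by
        rw [card_eq_zero, filter_eq_empty_iff]
        tauto
      omega
    · have h6 := six_mul_card_triple_le hk hn hF (Ne.symm hux) (Ne.symm hvx) (Ne.symm hvu) hxy huy
        hvy
      omega
  subst hvu
  -- The members with `x` but not `v` miss `y`, or miss `z`, or contain both: three classes of at
  -- most `M/6`. The centre `v` need not lie in `D`.
  have h1 := hbig v x hx hvx
  have h2 := card_filter_le_add F (fun A => v ∉ A ∧ x ∈ A)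
    (fun A => x ∈ A ∧ y ∉ A ∧ v ∉ A) (fun A => x ∈ A ∧ y ∈ A ∧ v ∉ A) (by tauto)
  have h3 := card_filter_le_add F (fun A => x ∈ A ∧ y ∈ A ∧ v ∉ A)
    (fun A => x ∈ A ∧ z ∉ A ∧ v ∉ A) (fun A => x ∈ A ∧ y ∈ A ∧ z ∈ A ∧ v ∉ A) (by tauto)
  have h4 := six_mul_card_triple_le hk hn hF hxy (Ne.symm hzx) (Ne.symm hzy) (Ne.symm hux)
    (Ne.symm huy) hzu
  omega

end Degree

theorem theorem1p5 (n k : ℕ) (hk : 3 ≤ k) (hn : 6 * k - 9 ≤ n)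
    (F : Finset (Finset (Fin n)))
    (hF : (F : Set (Finset (Fin n))).Sized k)
    (hint : (F : Set (Finset (Fin n))).Intersecting) :
    ithLargestDegree F (2 * k + 1) (by omega) (by omega) ≤ (n - 2).choose (k - 2) := by
  -- Positions are counted from 0, so `Iic m` gives the `2k+1` vertices of largest degree, all of
  -- degree at least that at position `m`.
  let m : Fin n := ⟨2 * k + 1 - 1, by omega⟩
  let D : Finset (Fin n) := (Finset.Iic m).map (degreeOrdering F).toEmbedding
  obtain ⟨y, hy, hy'⟩ := exists_card_filter_mem_le (F := F) (D := D) hk (by omega)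
    (fun A hA => hF hA) (fun A hA B hB => hint hA hB)
    (by simp [D, m, Fin.card_Iic])
  obtain ⟨i, hi, rfl⟩ := Finset.mem_map.1 hy
  exact (degreeOrdering_antitone F (Finset.mem_Iic.1 hi)).trans hy'
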